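/- Let $X$ be a complex Banach space, $L(X)$ the algebra of bounded linear operators on $X$, $F_0(X)$ and $K(X)$ its ideals of finite rank and of compact operators, $\mathcal{C}_0(X)=L(X)/F_0(X)$, $\mathcal{C}(X)=L(X)/K(X)$, and $\pi:L(X)\to\mathcal{C}_0(X)$, $\Pi:L(X)\to\mathcal{C}(X)$ the natural projections. In a unital ring $A$: $\mathrm{comm}^2(a)$ is the set of elements that commute with every $y\in A$ commuting with $a$; $a$ is quasinilpotent if $1-xa$ is invertible for every $x\in A$ commuting with $a$; and, for an idempotent $p\in A$, $a$ is right $p$-invertible if $ap=pa$ and there is $b\in A$ with $bp=pb$ and $(a+p)b=1$. For $T\in L(X)$: - $\pi(T)$ is right generalized Drazin invertible in $\mathcal{C}_0(X)$ if there is an idempotent $P\in L(X)$ with $\pi(P)\in\mathrm{comm}^2(\pi(T))$, $\pi(P)\pi(T)$ quasinilpotent and $\pi(T)$ right $\pi(P)$-invertible in $\mathcal{C}_0(X)$. - An idempotent $P\in L(X)$ is (right) associated to $T$ in $\mathcal{C}(X)$ if $\Pi(P)$ commutes with $\Pi(T)$, $\Pi(P)\Pi(T)$ is quasinilpotent and $\Pi(T)$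 is right $\Pi(P)$-invertible in $\mathcal{C}(X)$; $T$ is a right pseudo semi-B-Fredholm operator if such a $P$ exists. - An operator $S$ on a Banach space $E$ is right semi-Fredholm if its range is closed and of finite codimension and there is a bounded projection of $E$ onto its null space. It is Riesz if $S-\lambda I$ is Fredholm for every $\lambda\in\mathbb{C}\setminus\{0\}$. It is Riesz-right semi-Fredholm if $E=M\oplus N$ for closed $S$-invariant subspaces $M,N$ such that $S_{|M}$ is Riesz and $S_{|N}$ is right semi-Fredholm. - For an idempotent $P\in L(X)$, $T_1=(PTP)_{|R(P)}$, as an operator on $R(P)$, and $T_2=((I-P)T(I-P))_{|R(I-P)}$, as an operator on $R(I-P)=N(P)$. **Theorem.** Let $T\in L(X)$. The following are equivalent: 1. $\pi(T)$ is right generalized Drazin invertible in $\mathcal{C}_0(X)$. 2. $T$ is a right pseudo semi-B-Fredholm operator and there is an idempotent $P\in L(X)$, associated to $T$ in $\mathcal{C}(X)$, such that $\pi(P)\in\mathrm{comm}^2(\pi(T))$. 3. There is an idempotent $P\in L(X)$ such that $\pi(P)\in\mathrm{comm}^2(\pi(T))$, $T_1$ is a Riesz operator and $T_2$ is a right semi-Fredholm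 operator. In this case $T$ is a finite rank perturbation of a Riesz-right semi-Fredholm operator, i.e. $T=R+F$ with $R\in L(X)$ Riesz-right semi-Fredholm and $F\in F_0(X)$. -/

import Mathlib

namespace PseudoFredholm

/-! ### Ring-theoretic notions -/

section Ring

variable {A : Type*} [Ring A]

/-- The double commutant `comm²(a)`: the elements commuting with everything that commutes
with `a`. -/
def comm2 (a : A) : Set A := {x | ∀ y, y * a = a * y → x * y = y * x}

/-- `a` is quasinilpotent in the ring `A` (in the sense of Harte): `1 - x a` is invertible for
every `x` commuting with `a`. -/
def IsQuasinilpotent (a : A) : Prop := ∀ x : A, x * a = a * x → IsUnit (1 - x * a)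

/-- `a` is right `p`-invertible: `a` commutes with `p`, and `a + p` has a right inverse inside the
commutant `{x | x p = p x}` of `p`. -/
def IsRightPInvertible (p a : A) : Prop :=
  a * p = p * a ∧ ∃ b : A, b * p = p * b ∧ (a + p) * b = 1

end Ring

/-! ### The algebras `C₀(X) = L(X)/F₀(X)` and `C(X) = L(X)/K(X)` -/

section Quotients

variable (X : Type*) [NormedAddCommGroup X] [NormedSpace ℂ X]

/-- The ideal `F₀(X)` of finite rank operators. -/
def finiteRankIdeal : Ideal (X →L[ℂ] X) where
  carrier := {T | (T : X →ₗ[ℂ] X).HasFiniteRange}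
  add_mem' := fun hS hT => LinearMap.HasFiniteRange.add hS hT
  zero_mem' := LinearMap.HasFiniteRange.zero
  smul_mem' := fun S _ hT => LinearMap.HasFiniteRange.comp_left hT (S : X →ₗ[ℂ] X)

/-- The ideal `K(X)` of compact operators. -/
def compactIdeal : Ideal (X →L[ℂ] X) where
  carrier := {T | IsCompactOperator T}
  add_mem' := fun hS hT => hS.add hT
  zero_mem' := isCompactOperator_zero
  smul_mem' := fun S _ hT => hT.clm_comp S

instance : (finiteRankIdeal X).IsTwoSided where
  mul_mem_of_left := fun S hT => LinearMap.HasFiniteRange.comp_right hT (S : X →ₗ[ℂ] X)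

instance : (compactIdeal X).IsTwoSided where
  mul_mem_of_left := fun S hT => IsCompactOperator.comp_clm hT S

/-- The algebra `C₀(X) = L(X)/F₀(X)`. -/
abbrev CalkinZero : Type _ := (X →L[ℂ] X) ⧸ finiteRankIdeal X

/-- The Calkin algebra `C(X) = L(X)/K(X)`. -/
abbrev Calkin : Type _ := (X →L[ℂ] X) ⧸ compactIdeal X

end Quotients

section Operators

variable {X : Type*} [NormedAddCommGroup X] [NormedSpace ℂ X]

/-- The natural projection `π : L(X) → C₀(X)`. -/
def toCalkinZero : (X →L[ℂ] X) →+* CalkinZero X := Ideal.Quotient.mk (finiteRankIdeal X)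

/-- The natural projection `Π : L(X) → C(X)`. -/
def toCalkin : (X →L[ℂ] X) →+* Calkin X := Ideal.Quotient.mk (compactIdeal X)

/-- The idempotent `P` witnesses that `π(T)` is right generalized Drazin invertible in `C₀(X)`
("`P` is associated to `T` in `C₀(X)`"). -/
structure IsRightAssociatedZero (P T : X →L[ℂ] X) : Prop where
  idem : IsIdempotentElem P
  comm : toCalkinZero P ∈ comm2 (toCalkinZero T)
  quasinilpotent : IsQuasinilpotent (toCalkinZero P * toCalkinZero T)
  rightInvertible : IsRightPInvertible (toCalkinZero P) (toCalkinZero T)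

/-- `π(T)` is right generalized Drazin invertible in `C₀(X)`. -/
def IsRightGDrazinInvertibleZero (T : X →L[ℂ] X) : Prop :=
  ∃ P : X →L[ℂ] X, IsRightAssociatedZero P T

/-- The idempotent `P` witnesses that `Π(T)` is right generalized Drazin invertible in the Calkin
algebra ("`P` is associated to `T` in `C(X)`"). Here only plain commutation is required. -/
structure IsRightAssociated (P T : X →L[ℂ] X) : Prop where
  idem : IsIdempotentElem P
  comm : toCalkin P * toCalkin T = toCalkin T * toCalkin P
  quasinilpotent : IsQuasinilpotent (toCalkin P * toCalkin T)
  rightInvertible : IsRightPInvertible (toCalkin P) (toCalkin T)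

/-- `T` is a right pseudo semi-B-Fredholm operator: `Π(T)` is right generalized Drazin invertible
in the Calkin algebra. -/
def IsRightPseudoSemiBFredholm (T : X →L[ℂ] X) : Prop :=
  ∃ P : X →L[ℂ] X, IsRightAssociated P T

/-- `T` is right semi-Fredholm (`T ∈ Φ_r(X)`): its range is closed and of finite codimension, and
there is a bounded projection of `X` onto its null space. -/
structure IsRightSemiFredholm (T : X →L[ℂ] X) : Prop where
  isClosed_range : IsClosed (T.range : Set X)
  finite_coker : FiniteDimensional ℂ (X ⧸ T.range)
  ker_complemented : T.ker.ClosedComplemented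

/-- `T` is a Riesz operator: `T - λ I` is Fredholm for every nonzero complex `λ`. -/
def IsRiesz (T : X →L[ℂ] X) : Prop :=
  ∀ c : ℂ, c ≠ 0 → (T - c • (1 : X →L[ℂ] X)).IsFredholm

/-- The compression `(P T P)|_{R(P)} : R(P) → R(P)`. -/
def compression (P T : X →L[ℂ] X) : P.range →L[ℂ] P.range :=
  (P * T * P).restrict fun x _ => LinearMap.mem_range_self (P : X →ₗ[ℂ] X) (T (P x))

/-- `T` is a Riesz-right semi-Fredholm operator: `X = M ⊕ N` with `M`, `N` closed and
`T`-invariant, `T|_M` Riesz and `T|_N` right semi-Fredholm. -/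
def IsRieszRightSemiFredholm (T : X →L[ℂ] X) : Prop :=
  ∃ (M N : Submodule ℂ X) (hM : ∀ x ∈ M, T x ∈ M) (hN : ∀ x ∈ N, T x ∈ N),
    IsClosed (M : Set X) ∧ IsClosed (N : Set X) ∧ IsCompl M N ∧
      IsRiesz (T.restrict hM) ∧ IsRightSemiFredholm (T.restrict hN)

end Operators

end PseudoFredholm

namespace PseudoFredholm

open ContinuousLinearMap

/-! ### Atkinson theory: one-sided inverses modulo finite rank and modulo compact operators -/

section FiniteRank

variable {E : Type*} [NormedAddCommGroup E] [NormedSpace ℂ E]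

/-! Everything rests on two translations between operators and quotient algebras. First, on a Banach
space, being right invertible modulo finite rank operators, being right invertible modulo compact
operators, and being right semi-Fredholm are the same (`isRightSemiFredholm_iff_toCalkinZero`,
`exists_toCalkinZero_mul_eq_one_iff`); the two-sided version gives Atkinson's theorem. The bridge
from compact to finite rank is that `1 - K` is already a unit modulo finite rank for compact `K`.
Second, being Riesz is the same as being quasinilpotent in either quotient (Ruston). For the Calkin
algebra this is the spectral radius formula; the result is then carried to `C₀(X)` because units
agree in both quotients.

When `P` commutes with `T` in a quotient, `T` is block diagonal there, so `π(P)π(T)` is represented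
by the block `T₁`, and `T + P` by the blocks `T₁ + 1` and `T₂`. Quasinilpotency of the first is the
Riesz property of `T₁`. If `T₁` is Riesz, `T₁ + 1` is Fredholm, so right `P`-invertibility amounts
to right invertibility of `T₂`. The double commutant condition is the same in all three statements
and is only carried along. The final decomposition discards the off-diagonal blocks of `T`, which
have finite rank. -/

theorem toCalkinZero_eq_zero {S : E →L[ℂ] E} :
    toCalkinZero S = 0 ↔ (S : E →ₗ[ℂ] E).HasFiniteRange :=
  Ideal.Quotient.eq_zero_iff_mem

theorem toCalkinZero_eq_iff {S R : E →L[ℂ] E} :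
    toCalkinZero S = toCalkinZero R ↔ ((S - R : E →L[ℂ] E) : E →ₗ[ℂ] E).HasFiniteRange := by
  rw [← toCalkinZero_eq_zero, map_sub, sub_eq_zero]

theorem toCalkinZero_surjective : Function.Surjective (toCalkinZero (X := E)) :=
  Ideal.Quotient.mk_surjective

theorem toCalkin_eq_zero {S : E →L[ℂ] E} : toCalkin S = 0 ↔ IsCompactOperator S :=
  Ideal.Quotient.eq_zero_iff_mem

theorem toCalkin_eq_iff {S R : E →L[ℂ] E} :
    toCalkin S = toCalkin R ↔ IsCompactOperator (S - R : E →L[ℂ] E) := by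
  rw [← toCalkin_eq_zero, map_sub, sub_eq_zero]

theorem toCalkin_surjective : Function.Surjective (toCalkin (X := E)) :=
  Ideal.Quotient.mk_surjective

/-- Finite rank operators are compact. -/
theorem isCompactOperator_of_hasFiniteRange {S : E →L[ℂ] E}
    (hS : (S : E →ₗ[ℂ] E).HasFiniteRange) : IsCompactOperator S := by
  have : FiniteDimensional ℂ S.range := Module.Finite.of_fg hS
  have : ProperSpace S.range := FiniteDimensional.proper ℂ _
  exact (isCompactOperator_of_locallyCompactSpace_rng S.range.subtypeL).comp_clm
    (S.codRestrict S.range fun x => LinearMap.mem_range_self (S : E →ₗ[ℂ] E) x)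

/-- The canonical projection `C₀(X) → C(X)`. -/
def calkinZeroToCalkin : CalkinZero E →+* Calkin E :=
  Ideal.Quotient.factor fun _ hS => isCompactOperator_of_hasFiniteRange hS

@[simp] theorem calkinZeroToCalkin_toCalkinZero (S : E →L[ℂ] E) :
    calkinZeroToCalkin (toCalkinZero S) = toCalkin S := rfl

/-- **Atkinson's theorem**, modulo finite rank operators. -/
theorem isFredholm_iff_isUnit_toCalkinZero {S : E →L[ℂ] E} :
    S.IsFredholm ↔ IsUnit (toCalkinZero S) := by
  rw [isFredholm_iff_exists_isQuasiInverse, isUnit_iff_exists]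
  constructor
  · rintro ⟨V, h₁, h₂⟩
    refine ⟨toCalkinZero V, ?_, ?_⟩
    · rw [← map_mul, ← map_one toCalkinZero, toCalkinZero_eq_iff]
      exact LinearMap.FiniteRangeSetoid.equiv_iff_hasFiniteRange.1 h₂
    · rw [← map_mul, ← map_one toCalkinZero, toCalkinZero_eq_iff]
      exact LinearMap.FiniteRangeSetoid.equiv_iff_hasFiniteRange.1 h₁
  · rintro ⟨v, h₁, h₂⟩
    obtain ⟨V, rfl⟩ := toCalkinZero_surjective v
    rw [← map_mul, ← map_one toCalkinZero, toCalkinZero_eq_iff] at h₁ h₂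
    exact ⟨V, LinearMap.FiniteRangeSetoid.equiv_iff_hasFiniteRange.2 h₂,
      LinearMap.FiniteRangeSetoid.equiv_iff_hasFiniteRange.2 h₁⟩

/-- Finite rank operators are von Neumann regular. -/
theorem exists_mul_mul_eq_of_hasFiniteRange {F : E →L[ℂ] E}
    (hF : (F : E →ₗ[ℂ] E).HasFiniteRange) : ∃ D : E →L[ℂ] E, F * D * F = F := by
  have : FiniteDimensional ℂ F.range := Module.Finite.of_fg hF
  obtain ⟨p, hp⟩ := Submodule.ClosedComplemented.of_finiteDimensional F.range
  obtain ⟨g, hg⟩ := LinearMap.exists_rightInverse_of_surjective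
    (F : E →ₗ[ℂ] E).rangeRestrict (LinearMap.range_rangeRestrict _)
  refine ⟨(LinearMap.toContinuousLinearMap g) ∘L p, ?_⟩
  ext x
  have h₁ : p (F x) = ⟨F x, LinearMap.mem_range_self (F : E →ₗ[ℂ] E) x⟩ :=
    hp ⟨F x, LinearMap.mem_range_self (F : E →ₗ[ℂ] E) x⟩
  have h₂ := congrArg Subtype.val (LinearMap.congr_fun hg (p (F x)))
  simp only [LinearMap.comp_apply, LinearMap.id_apply] at h₂
  change F (g (p (F x))) = F x
  rw [h₁] at h₂ ⊢
  exact h₂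

/-- If `S W = 1` modulo finite rank operators, then `S` is von Neumann regular. -/
theorem exists_mul_mul_eq_of_toCalkinZero_mul_eq_one {S W : E →L[ℂ] E}
    (h : toCalkinZero S * toCalkinZero W = 1) : ∃ V : E →L[ℂ] E, S * V * S = S := by
  have hF : toCalkinZero (S - S * W * S) = 0 := by
    rw [map_sub, map_mul, map_mul, h, one_mul, sub_self]
  obtain ⟨D, hD⟩ := exists_mul_mul_eq_of_hasFiniteRange (toCalkinZero_eq_zero.1 hF)
  -- The correction to `W` is chosen so that `S` turns its outer factors into the defect `S - S * W
  -- * S`, which `D` inverts in the regular sense.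
  refine ⟨W + (1 - W * S) * D * (1 - S * W), ?_⟩
  calc S * (W + (1 - W * S) * D * (1 - S * W)) * S
      = S * W * S + (S - S * W * S) * D * (S - S * W * S) := by noncomm_ring
    _ = S := by rw [hD]; abel

/-- If the kernel of `S` is complemented and its range has finite codimension, then `S` is right
invertible modulo the finite rank operators. -/
theorem exists_toCalkinZero_mul_eq_one [CompleteSpace E] {S : E →L[ℂ] E}
    (hk : S.ker.ClosedComplemented) (hf : FiniteDimensional ℂ (E ⧸ S.range)) :
    ∃ w, toCalkinZero S * w = 1 := by
  obtain ⟨D, hD⟩ := S.range.exists_isCompl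
  obtain ⟨Z, hZ⟩ := hk.exists_isTopCompl
  have hfD : FiniteDimensional ℂ D :=
    (Submodule.quotientEquivOfIsCompl _ _ hD).finiteDimensional
  have hZc : IsClosed (Z : Set E) := hZ.symm.closedComplemented.isClosed
  have : CompleteSpace Z := hZc.completeSpace_coe
  have : CompleteSpace D := FiniteDimensional.complete ℂ D
  have hker : (S ∘L Z.subtypeL).ker = ⊥ := by
    rw [LinearMap.ker_eq_bot']
    intro z hz
    have : (z : E) ∈ S.ker ⊓ Z := ⟨hz, z.2⟩
    rw [hZ.isCompl.inf_eq_bot] at this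
    exact Subtype.ext this
  have hrange : (S ∘L Z.subtypeL).range = S.range := by
    apply le_antisymm
    · rintro _ ⟨z, rfl⟩
      exact ⟨z, rfl⟩
    · rintro _ ⟨x, rfl⟩
      have hx : x ∈ S.ker ⊔ Z := hZ.isCompl.sup_eq_top ▸ Submodule.mem_top
      obtain ⟨k, hk, z, hz, rfl⟩ := Submodule.mem_sup.1 hx
      refine ⟨⟨z, hz⟩, ?_⟩
      have hk' : S k = 0 := hk
      simp [hk']
  -- `(z, d) ↦ S z + d` is a topological isomorphism of `Z × D` onto `E`. The `Z`-component of its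
  -- inverse is a right inverse of `S` up to a map into the finite dimensional `D`.
  let e := coprodSubtypeLEquivOfIsCompl (S ∘L Z.subtypeL) (hrange ▸ hD) hker
  have he (y : E) : S (e.symm y).1 + (e.symm y).2 = y := e.apply_symm_apply y
  refine ⟨toCalkinZero (Z.subtypeL ∘L .fst ℂ Z D ∘L (e.symm : E →L[ℂ] Z × D)), ?_⟩
  rw [← map_mul, ← map_one toCalkinZero, toCalkinZero_eq_iff]
  have : (S * (Z.subtypeL ∘L .fst ℂ Z D ∘L (e.symm : E →L[ℂ] Z × D)) - 1 : E →L[ℂ] E)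
      = (D.subtypeL ∘L (-(.snd ℂ Z D ∘L (e.symm : E →L[ℂ] Z × D)))) := by
    ext y
    change S (e.symm y).1 - y = -((e.symm y).2 : E)
    rw [sub_eq_iff_eq_add, neg_add_eq_sub, eq_sub_iff_add_eq]
    exact he y
  rw [this]
  exact (LinearMap.HasFiniteRange.of_isNoetherian_rng
    (f := ((-(.snd ℂ Z D ∘L (e.symm : E →L[ℂ] Z × D)) : E →L[ℂ] D) : E →ₗ[ℂ] D))).comp_left
      D.subtype

/-- An operator is right semi-Fredholm if and only if it is right invertible modulo the finite
rank operators. -/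
theorem isRightSemiFredholm_iff_toCalkinZero [CompleteSpace E] {S : E →L[ℂ] E} :
    IsRightSemiFredholm S ↔ ∃ w, toCalkinZero S * w = 1 := by
  constructor
  · rintro ⟨-, hf, hk⟩
    exact exists_toCalkinZero_mul_eq_one hk hf
  · rintro ⟨w, hw⟩
    obtain ⟨W, rfl⟩ := toCalkinZero_surjective w
    obtain ⟨V, hV⟩ := exists_mul_mul_eq_of_toCalkinZero_mul_eq_one hw
    -- Regularity gives closedness of the range, as a kernel, and below it makes `1 - V * S` a
    -- projection onto `S.ker`.
    have hrange : S.range = (1 - S * V : E →L[ℂ] E).ker := by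
      ext y
      constructor
      · rintro ⟨x, rfl⟩
        have := DFunLike.congr_fun hV x
        simp only [mul_apply_eq_comp] at this
        simp [this]
      · intro hy
        have : y - S (V y) = 0 := hy
        exact ⟨V y, (sub_eq_zero.1 this).symm⟩
    refine ⟨?_, ?_, ?_⟩
    · rw [hrange]
      exact (1 - S * V : E →L[ℂ] E).isClosed_ker
    · rw [← map_mul, ← map_one toCalkinZero, eq_comm, toCalkinZero_eq_iff] at hw
      have := hw.cofg_ker
      refine this.of_le fun y hy => ?_
      have : y - S (W y) = 0 := hy
      exact ⟨W y, (sub_eq_zero.1 this).symm⟩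
    · have h₀ (x : E) : S (V (S x)) = S x := DFunLike.congr_fun hV x
      refine ⟨(1 - V * S).codRestrict S.ker fun x => ?_, fun x => Subtype.ext ?_⟩
      · simp [h₀]
      · have : S x = 0 := x.2
        simp [this]

/-- An operator with finite dimensional kernel and range of finite codimension is invertible modulo
the finite rank operators. -/
theorem isUnit_toCalkinZero_of_finiteDimensional [CompleteSpace E] {S : E →L[ℂ] E}
    (hk : FiniteDimensional ℂ S.ker) (hf : FiniteDimensional ℂ (E ⧸ S.range)) :
    IsUnit (toCalkinZero S) := by
  obtain ⟨w, hw⟩ := exists_toCalkinZero_mul_eq_one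
    (Submodule.ClosedComplemented.of_finiteDimensional S.ker) hf
  obtain ⟨W, rfl⟩ := toCalkinZero_surjective w
  obtain ⟨V, hV⟩ := exists_mul_mul_eq_of_toCalkinZero_mul_eq_one hw
  have h₀ (x : E) : S (V (S x)) = S x := DFunLike.congr_fun hV x
  have hVS : toCalkinZero V * toCalkinZero S = 1 := by
    rw [← map_mul, ← map_one toCalkinZero, eq_comm, toCalkinZero_eq_iff]
    have hle : (1 - V * S : E →L[ℂ] E).range ≤ S.ker := by
      rintro _ ⟨x, rfl⟩
      simp [h₀]
    exact Submodule.fg_iff_finiteDimensional _ |>.2 (Submodule.finiteDimensional_of_le hle)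
  exact isUnit_iff_exists.2 ⟨_, hw, left_inv_eq_right_inv hVS hw ▸ hVS⟩

/-- A compact perturbation of the identity is invertible modulo the finite rank operators. -/
theorem isUnit_toCalkinZero_one_sub_of_isCompactOperator [CompleteSpace E] {K : E →L[ℂ] E}
    (hK : IsCompactOperator K) : IsUnit (toCalkinZero (1 - K)) := by
  -- On this kernel `K` is the identity, and a space with compact identity is finite dimensional.
  have hker : FiniteDimensional ℂ (1 - K : E →L[ℂ] E).ker := by
    have hmem (x : E) (hx : x ∈ (1 - K : E →L[ℂ] E).ker) : K x = x := by
      have : x - K x = 0 := hx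
      exact (sub_eq_zero.1 this).symm
    have h := IsCompactOperator.restrict' (f := (K : E →ₗ[ℂ] E))
      (V := (1 - K : E →L[ℂ] E).ker) hK
      (fun x hx => by
        change K x ∈ _
        rwa [hmem x hx])
    refine FiniteDimensional.of_isCompactOperator_id ?_
    convert! h using 1
    ext x
    exact (hmem x x.2).symm
  -- An infinite dimensional cokernel need not be refuted: it leaves room to embed the kernel into
  -- it by `q`. Lifting `q` gives a finite rank `F` for which `1 - (K + F)` is injective, hence
  -- invertible by the Fredholm alternative, and it has the same class as `1 - K`.
  by_cases hfin : FiniteDimensional ℂ (E ⧸ (1 - K : E →L[ℂ] E).range)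
  · exact isUnit_toCalkinZero_of_finiteDimensional hker hfin
  set N := (1 - K : E →L[ℂ] E).ker
  set R := (1 - K : E →L[ℂ] E).range
  obtain ⟨p, hp⟩ := Submodule.ClosedComplemented.of_finiteDimensional N
  obtain ⟨q, hq⟩ : ∃ q : N →ₗ[ℂ] E ⧸ R, Function.Injective q :=
    rank_le_iff_exists_linearMap.1 <| (Module.rank_lt_aleph0 ℂ N).le.trans
      (not_lt.1 fun h => hfin (Module.rank_lt_aleph0_iff.1 h))
  obtain ⟨g, hg⟩ := LinearMap.exists_rightInverse_of_surjective R.mkQ R.range_mkQ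
  set F : E →L[ℂ] E := (LinearMap.toContinuousLinearMap (g ∘ₗ q)) ∘L p with hF
  have hFfin : (F : E →ₗ[ℂ] E).HasFiniteRange :=
    (LinearMap.HasFiniteRange.of_isNoetherian_rng (f := (p : E →ₗ[ℂ] N))).comp_left (g ∘ₗ q)
  have hKF : IsCompactOperator (K + F : E →L[ℂ] E) :=
    hK.add (isCompactOperator_of_hasFiniteRange hFfin)
  have hinj (x : E) (hx : (K + F) x = x) : x = 0 := by
    have hx' : (1 - K) x = F x := by
      change x - K x = F x
      rw [sub_eq_iff_eq_add']
      exact hx.symm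
    have hqx : q (p x) = 0 := by
      have h₁ : R.mkQ (F x) = q (p x) := LinearMap.congr_fun hg (q (p x))
      rw [← h₁, ← hx']
      exact (Submodule.Quotient.mk_eq_zero R).2 ⟨x, rfl⟩
    have hpx : p x = 0 := hq (by rw [hqx, map_zero])
    have hFx : F x = 0 := by simp [hF, hpx]
    have hxN : x ∈ N := by
      change (1 - K) x = 0
      rw [hx', hFx]
    simpa [hpx] using (congrArg Subtype.val (hp ⟨x, hxN⟩)).symm
  have hu : IsUnit (1 - (K + F)) := by
    have := (hKF.hasEigenvalue_or_mem_resolventSet one_ne_zero).resolve_left fun h => by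
      obtain ⟨x, hx⟩ := h.exists_hasEigenvector
      exact hx.2 (hinj x (by simpa using hx.apply_eq_smul))
    simpa [spectrum.mem_resolventSet_iff] using this
  have : toCalkinZero (1 - K) = toCalkinZero (1 - (K + F)) := by
    rw [toCalkinZero_eq_iff]
    convert! hFfin using 2
    abel
  rw [this]
  exact hu.map _

/-- Invertibility modulo the compact operators and modulo the finite rank operators agree. -/
theorem exists_toCalkinZero_mul_eq_one_iff [CompleteSpace E] {S : E →L[ℂ] E} :
    (∃ w, toCalkinZero S * w = 1) ↔ ∃ w, toCalkin S * w = 1 := by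
  constructor
  · rintro ⟨w, hw⟩
    exact ⟨calkinZeroToCalkin w, by
      rw [← calkinZeroToCalkin_toCalkinZero, ← map_mul, hw, map_one]⟩
  · rintro ⟨w, hw⟩
    obtain ⟨W, rfl⟩ := toCalkin_surjective w
    rw [← map_mul, ← map_one toCalkin, eq_comm, toCalkin_eq_iff] at hw
    -- `S * W` is `1` minus a compact operator, so a finite rank right inverse of it, multiplied by
    -- `W`, serves `S`.
    obtain ⟨u, hu⟩ := (isUnit_toCalkinZero_one_sub_of_isCompactOperator hw).exists_right_inv
    rw [sub_sub_cancel, map_mul, mul_assoc] at hu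
    exact ⟨_, hu⟩

theorem exists_mul_toCalkinZero_eq_one_iff [CompleteSpace E] {S : E →L[ℂ] E} :
    (∃ w, w * toCalkinZero S = 1) ↔ ∃ w, w * toCalkin S = 1 := by
  constructor
  · rintro ⟨w, hw⟩
    exact ⟨calkinZeroToCalkin w, by
      rw [← calkinZeroToCalkin_toCalkinZero, ← map_mul, hw, map_one]⟩
  · rintro ⟨w, hw⟩
    obtain ⟨W, rfl⟩ := toCalkin_surjective w
    rw [← map_mul, ← map_one toCalkin, eq_comm, toCalkin_eq_iff] at hw
    obtain ⟨u, hu⟩ := (isUnit_toCalkinZero_one_sub_of_isCompactOperator hw).exists_left_inv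
    rw [sub_sub_cancel, map_mul, ← mul_assoc] at hu
    exact ⟨_, hu⟩

theorem isUnit_toCalkinZero_iff [CompleteSpace E] {S : E →L[ℂ] E} :
    IsUnit (toCalkinZero S) ↔ IsUnit (toCalkin S) := by
  simp only [isUnit_iff_exists_and_exists, exists_toCalkinZero_mul_eq_one_iff,
    exists_mul_toCalkinZero_eq_one_iff]

theorem isRightSemiFredholm_iff_toCalkin [CompleteSpace E] {S : E →L[ℂ] E} :
    IsRightSemiFredholm S ↔ ∃ w, toCalkin S * w = 1 :=
  isRightSemiFredholm_iff_toCalkinZero.trans exists_toCalkinZero_mul_eq_one_iff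

theorem isFredholm_iff_isUnit_toCalkin [CompleteSpace E] {S : E →L[ℂ] E} :
    S.IsFredholm ↔ IsUnit (toCalkin S) :=
  isFredholm_iff_isUnit_toCalkinZero.trans isUnit_toCalkinZero_iff

end FiniteRank

end PseudoFredholm

namespace PseudoFredholm

/-! ### Spectral radius zero and quasinilpotency -/

section Quasinilpotent

open Filter Topology in
/-- In a complex Banach algebra, an element without nonzero spectral values is quasinilpotent. -/
theorem isQuasinilpotent_of_forall_isUnit {A : Type*} [NormedRing A] [NormedAlgebra ℂ A]
    [CompleteSpace A] {a : A} (h : ∀ c : ℂ, c ≠ 0 → IsUnit (a - algebraMap ℂ A c)) :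
    IsQuasinilpotent a := by
  intro y hy
  have hr : spectralRadius ℂ a = 0 := by
    refine le_antisymm (iSup₂_le fun c hc => ?_) bot_le
    have : c = 0 := by
      by_contra h0
      exact hc (by simpa [spectrum.mem_resolventSet_iff] using (h c h0).neg)
    simp [this]
  have htend := spectrum.pow_nnnorm_pow_one_div_tendsto_nhds_spectralRadius a
  rw [hr] at htend
  -- Since `‖a ^ n‖ < ε ^ n` for some positive `n`, this choice forces `‖y‖ ^ n * ‖a ^ n‖ < 1`; the
  -- `+ 1` covers `y = 0`.
  set ε : NNReal := (‖y‖₊ + 1)⁻¹ with hε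
  have hεpos : 0 < ε := by positivity
  obtain ⟨n, hn, hnpos⟩ := ((htend.eventually_lt_const
    (ENNReal.coe_pos.2 hεpos)).and (eventually_gt_atTop 0)).exists
  have hn' : ‖a ^ n‖₊ < ε ^ n := by
    have hn0 : (0 : ℝ) < n := by exact_mod_cast hnpos
    have := ENNReal.rpow_lt_rpow hn hn0
    rw [← ENNReal.rpow_mul, one_div_mul_cancel hn0.ne', ENNReal.rpow_one,
      ENNReal.rpow_natCast] at this
    exact_mod_cast this
  have hcomm : Commute y a := hy
  have hlt : ‖(y * a) ^ n‖ < 1 := by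
    rw [hcomm.mul_pow]
    have h₁ : ‖y ^ n * a ^ n‖₊ ≤ ‖y‖₊ ^ n * ‖a ^ n‖₊ :=
      (nnnorm_mul_le _ _).trans (mul_le_mul_left (nnnorm_pow_le' y hnpos) _)
    have h₂ : ‖y‖₊ ^ n * ‖a ^ n‖₊ ≤ (‖y‖₊ + 1) ^ n * ‖a ^ n‖₊ := by
      gcongr
      exact le_self_add
    have h₃ : (‖y‖₊ + 1) ^ n * ‖a ^ n‖₊ < (‖y‖₊ + 1) ^ n * ε ^ n := by
      gcongr
    have h₄ : (‖y‖₊ + 1) ^ n * ε ^ n = 1 := by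
      rw [← mul_pow, hε, mul_inv_cancel₀ (by positivity), one_pow]
    exact_mod_cast (h₁.trans h₂).trans_lt (h₃.trans_eq h₄)
  have hu : IsUnit (1 - (y * a) ^ n) := isUnit_one_sub_of_norm_lt_one hlt
  -- `1 - (y * a) ^ n` factors as `1 - y * a` times a geometric sum; commuting factors of a unit are
  -- units.
  rw [← mul_neg_geom_sum] at hu
  have hc : Commute (1 - y * a) (∑ i ∈ Finset.range n, (y * a) ^ i) :=
    (Commute.one_left _).sub_left (Commute.sum_right _ _ _ fun i _ => (Commute.refl _).pow_right i)
  exact (hc.isUnit_mul_iff.1 hu).1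

end Quasinilpotent

/-! ### Riesz operators as quasinilpotents of the Calkin algebra -/

section CalkinAlgebra

variable {E : Type*} [NormedAddCommGroup E] [NormedSpace ℂ E] [CompleteSpace E]

/-- The Calkin algebra is a normed ring for the quotient norm. -/
noncomputable abbrev calkinNormedRing : NormedRing (Calkin E) :=
  have : IsClosed (compactIdeal E : Set (E →L[ℂ] E)) := isClosed_setOfPred_isCompactOperator
  { (Submodule.Quotient.normedAddCommGroup (compactIdeal E) : NormedAddCommGroup (Calkin E)),
    Ideal.Quotient.ring (compactIdeal E) with
    norm_mul_le := fun x y => le_of_forall_pos_le_add fun ε hε => by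
      have hlim : Filter.Tendsto (fun δ : ℝ => (‖x‖ + δ) * (‖y‖ + δ)) (nhdsWithin 0 (Set.Ioi 0))
          (nhds (‖x‖ * ‖y‖)) := by
        have : Continuous fun δ : ℝ => (‖x‖ + δ) * (‖y‖ + δ) := by fun_prop
        simpa using (this.tendsto 0).mono_left nhdsWithin_le_nhds
      obtain ⟨δ, hδ, hδ0⟩ := ((hlim.eventually_lt_const (lt_add_of_pos_right _ hε)).and
        self_mem_nhdsWithin).exists
      obtain ⟨a, rfl, ha⟩ := Submodule.Quotient.norm_mk_lt x hδ0
      obtain ⟨b, rfl, hb⟩ := Submodule.Quotient.norm_mk_lt y hδ0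
      refine le_trans ?_ hδ.le
      refine (Submodule.Quotient.norm_mk_le (compactIdeal E) (a * b)).trans ?_
      exact (norm_mul_le a b).trans (mul_le_mul ha.le hb.le (norm_nonneg _)
        ((norm_nonneg _).trans ha.le)) }

/-- An operator whose class in the Calkin algebra has no nonzero spectral value is quasinilpotent
there. -/
theorem isQuasinilpotent_toCalkin_of_forall_isUnit {S : E →L[ℂ] E}
    (h : ∀ c : ℂ, c ≠ 0 → IsUnit (toCalkin (S - c • 1))) : IsQuasinilpotent (toCalkin S) := by
  let _ : NormedRing (Calkin E) := calkinNormedRing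
  let _ : NormedAlgebra ℂ (Calkin E) :=
    { (inferInstance : Algebra ℂ (Calkin E)) with
      norm_smul_le := (Submodule.Quotient.normedSpace (compactIdeal E) ℂ).norm_smul_le }
  have : CompleteSpace (Calkin E) := Submodule.Quotient.completeSpace (compactIdeal E)
  refine isQuasinilpotent_of_forall_isUnit fun c hc => ?_
  have := h c hc
  rw [map_sub] at this
  exact this

omit [CompleteSpace E] in
/-- If the image of `S` under a ring homomorphism is quasinilpotent, then the images of its nonzero
translates are invertible. -/
theorem isUnit_map_sub_smul_one {A : Type*} [Ring A] (f : (E →L[ℂ] E) →+* A) {S : E →L[ℂ] E}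
    (h : IsQuasinilpotent (f S)) {c : ℂ} (hc : c ≠ 0) : IsUnit (f (S - c • 1)) := by
  -- Quasinilpotency is applied to the scalar `c⁻¹`, and `S - c = -c (1 - c⁻¹ S)`.
  have h₁ := h (f (c⁻¹ • 1)) (by rw [← map_mul, ← map_mul]; simp)
  have h₂ : IsUnit (f ((-c) • (1 : E →L[ℂ] E))) := by
    refine IsUnit.map _ (isUnit_iff_exists.2 ⟨(-c)⁻¹ • 1, ?_, ?_⟩) <;> simp [smul_smul, hc]
  have h₃ := h₂.mul h₁
  rw [← map_one f, ← map_mul, ← map_sub, ← map_mul] at h₃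
  convert! h₃ using 2
  simp [smul_smul, hc, sub_eq_add_neg, add_comm]

/-- **Ruston's characterization** of Riesz operators. -/
theorem isRiesz_iff_isQuasinilpotent_toCalkin {S : E →L[ℂ] E} :
    IsRiesz S ↔ IsQuasinilpotent (toCalkin S) := by
  constructor
  · intro h
    exact isQuasinilpotent_toCalkin_of_forall_isUnit fun c hc =>
      isFredholm_iff_isUnit_toCalkin.1 (h c hc)
  · intro h c hc
    exact isFredholm_iff_isUnit_toCalkin.2 (isUnit_map_sub_smul_one _ h hc)

/-- The spectral radius argument needs a Banach algebra, so it is run in the Calkin algebra: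
commuting elements of `C₀` map to commuting elements there, and the resulting unit lifts back by
`isUnit_toCalkinZero_iff`. -/
theorem isRiesz_iff_isQuasinilpotent_toCalkinZero {S : E →L[ℂ] E} :
    IsRiesz S ↔ IsQuasinilpotent (toCalkinZero S) := by
  constructor
  · intro h y hy
    obtain ⟨Y, rfl⟩ := toCalkinZero_surjective y
    have hY : toCalkin Y * toCalkin S = toCalkin S * toCalkin Y := by
      simpa using congrArg calkinZeroToCalkin hy
    have := isRiesz_iff_isQuasinilpotent_toCalkin.1 h (toCalkin Y) hY
    rw [← map_mul, ← map_one toCalkin, ← map_sub] at this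
    rw [← map_mul, ← map_one toCalkinZero, ← map_sub]
    exact isUnit_toCalkinZero_iff.2 this
  · intro h c hc
    exact isFredholm_iff_isUnit_toCalkinZero.2 (isUnit_map_sub_smul_one _ h hc)

end CalkinAlgebra

end PseudoFredholm

namespace PseudoFredholm

open ContinuousLinearMap

/-! ### Passing between operators on the range of `P` and operators on `X` -/

section Corner

variable {X : Type*} [NormedAddCommGroup X] [NormedSpace ℂ X]

/-- An idempotent `P`, as a map onto its range. -/
def toRange (P : X →L[ℂ] X) : X →L[ℂ] P.range :=
  P.codRestrict P.range fun x => LinearMap.mem_range_self (P : X →ₗ[ℂ] X) x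

@[simp] theorem coe_toRange (P : X →L[ℂ] X) (x : X) : (toRange P x : X) = P x := rfl

/-- The compression of `S` to the range of `P`, as `ρ S J` with `J` the inclusion of the range and
`ρ` the map onto the range. -/
def corner (P S : X →L[ℂ] X) : P.range →L[ℂ] P.range := toRange P ∘L S ∘L P.range.subtypeL

/-- The operator on `X` which acts as `A` on the range of `P` and as zero on its kernel. -/
def extend (P : X →L[ℂ] X) (A : P.range →L[ℂ] P.range) : X →L[ℂ] X :=
  P.range.subtypeL ∘L A ∘L toRange P

@[simp] theorem coe_corner_apply (P S : X →L[ℂ] X) (x : P.range) :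
    (corner P S x : X) = P (S x) := rfl

@[simp] theorem extend_apply (P : X →L[ℂ] X) (A : P.range →L[ℂ] P.range) (x : X) :
    extend P A x = A (toRange P x) := rfl

variable {P : X →L[ℂ] X}

theorem apply_apply_of_isIdempotentElem (hP : IsIdempotentElem P) (x : X) : P (P x) = P x :=
  DFunLike.congr_fun hP x

theorem apply_coe_range (hP : IsIdempotentElem P) (x : P.range) : P (x : X) = x := by
  obtain ⟨_, y, rfl⟩ := x
  exact apply_apply_of_isIdempotentElem hP y

theorem isClosed_range_of_isIdempotentElem (hP : IsIdempotentElem P) :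
    IsClosed (P.range : Set X) := by
  have : P.range = (1 - P : X →L[ℂ] X).ker := by
    ext y
    constructor
    · rintro ⟨x, rfl⟩
      simp [apply_apply_of_isIdempotentElem hP]
    · intro hy
      have : y - P y = 0 := hy
      exact ⟨y, (sub_eq_zero.1 this).symm⟩
  rw [this]
  exact (1 - P : X →L[ℂ] X).isClosed_ker

theorem completeSpace_range [CompleteSpace X] (hP : IsIdempotentElem P) :
    CompleteSpace P.range :=
  (isClosed_range_of_isIdempotentElem hP).completeSpace_coe

theorem compression_eq_corner (hP : IsIdempotentElem P) (T : X →L[ℂ] X) :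
    compression P T = corner P T := by
  ext x
  change P (T (P x)) = P (T x)
  rw [apply_coe_range hP]

theorem corner_one (hP : IsIdempotentElem P) : corner P 1 = 1 := by
  ext x
  simp [apply_coe_range hP]

/-- Compression is multiplicative only up to the inserted `P`, which is harmless once a factor
commutes with `P`. -/
theorem corner_mul_corner (S R : X →L[ℂ] X) :
    corner P S * corner P R = corner P (S * P * R) := rfl

theorem corner_sub (S R : X →L[ℂ] X) : corner P (S - R) = corner P S - corner P R := by
  ext x
  simp

theorem corner_mul_mul (hP : IsIdempotentElem P) (S : X →L[ℂ] X) :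
    corner P (P * S * P) = corner P S := by
  ext x
  simp [apply_coe_range hP, apply_apply_of_isIdempotentElem hP]

theorem extend_mul_extend (hP : IsIdempotentElem P) (A B : P.range →L[ℂ] P.range) :
    extend P A * extend P B = extend P (A * B) := by
  ext x
  have (y : P.range) : toRange P (y : X) = y := Subtype.ext (apply_coe_range hP y)
  simp [this]

theorem extend_one : extend P 1 = P := rfl

theorem extend_corner (S : X →L[ℂ] X) :
    extend P (corner P S) = P * S * P := rfl

theorem extend_sub (A B : P.range →L[ℂ] P.range) :
    extend P (A - B) = extend P A - extend P B := by
  ext x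
  simp

theorem mul_extend (hP : IsIdempotentElem P) (A : P.range →L[ℂ] P.range) :
    P * extend P A = extend P A := by
  ext x
  exact apply_coe_range hP _

theorem extend_mul (hP : IsIdempotentElem P) (A : P.range →L[ℂ] P.range) :
    extend P A * P = extend P A := by
  ext x
  have : toRange P (P x) = toRange P x := Subtype.ext (apply_apply_of_isIdempotentElem hP x)
  simp [this]

/-- Compression is additive and preserves finite rank, so it descends to the quotients; likewise for
compact operators and for `extend` below. -/
theorem toCalkinZero_corner_congr {S R : X →L[ℂ] X} (h : toCalkinZero S = toCalkinZero R) :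
    toCalkinZero (corner P S) = toCalkinZero (corner P R) := by
  rw [toCalkinZero_eq_iff] at h ⊢
  rw [← corner_sub]
  exact (h.comp_right P.range.subtype).comp_left (toRange P : X →ₗ[ℂ] P.range)

theorem toCalkin_corner_congr {S R : X →L[ℂ] X} (h : toCalkin S = toCalkin R) :
    toCalkin (corner P S) = toCalkin (corner P R) := by
  rw [toCalkin_eq_iff] at h ⊢
  rw [← corner_sub]
  exact (h.comp_clm P.range.subtypeL).clm_comp (toRange P)

theorem toCalkinZero_extend_congr {A B : P.range →L[ℂ] P.range}
    (h : toCalkinZero A = toCalkinZero B) :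
    toCalkinZero (extend P A) = toCalkinZero (extend P B) := by
  rw [toCalkinZero_eq_iff] at h ⊢
  rw [← extend_sub]
  exact (h.comp_right (toRange P : X →ₗ[ℂ] P.range)).comp_left P.range.subtype

/-- The compression `P T P` is Riesz on `X` if and only if it is Riesz on the range of `P`. -/
theorem isRiesz_corner_iff (hP : IsIdempotentElem P) (T : X →L[ℂ] X) :
    IsRiesz (corner P T) ↔ IsRiesz (P * T * P) := by
  have hPP : P * P = P := hP
  constructor
  · intro h c hc
    obtain ⟨v, hv₁, hv₂⟩ := isUnit_iff_exists.1 (isFredholm_iff_isUnit_toCalkinZero.1 (h c hc))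
    obtain ⟨V, rfl⟩ := toCalkinZero_surjective v
    rw [← map_mul, ← map_one toCalkinZero] at hv₁ hv₂
    have h₁ := toCalkinZero_extend_congr hv₁
    have h₂ := toCalkinZero_extend_congr hv₂
    have hT : extend P (corner P T - c • 1) = P * T * P - c • P := by
      ext x
      simp
    rw [← extend_mul_extend hP, extend_one, hT] at h₁ h₂
    have hW : (1 - P) * extend P V = 0 := by rw [sub_mul, mul_extend hP, one_mul, sub_self]
    have hW' : extend P V * (1 - P) = 0 := by rw [mul_sub, extend_mul hP, mul_one, sub_self]
    have hQ : (1 - P) * (1 - P) = 1 - P := hP.one_sub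
    have hAQ : (P * T * P - c • P) * (1 - P) = 0 := by
      simp [mul_sub, sub_mul, mul_assoc, hPP]
    have hQA : (1 - P) * (P * T * P - c • P) = 0 := by
      simp [mul_sub, sub_mul, ← mul_assoc, hPP]
    have hS : P * T * P - c • 1 = (P * T * P - c • P) - c • (1 - P) := by
      rw [smul_sub]; abel
    rw [isFredholm_iff_isUnit_toCalkinZero, hS]
    generalize P * T * P - c • P = A at *
    generalize hQdef : 1 - P = Q at *
    have hPQ : P + Q = 1 := by rw [← hQdef, add_sub_cancel]
    -- The inverse is built blockwise: `V` on the range of `P`, and `-c⁻¹` on its kernel, where `P *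
    -- T * P - c` is just `-c`.
    refine isUnit_iff_exists.2 ⟨toCalkinZero (extend P V - c⁻¹ • Q), ?_, ?_⟩
    · have : (A - c • Q) * (extend P V - c⁻¹ • Q) = A * extend P V + Q := by
        simp [mul_sub, sub_mul, hAQ, hQ, hW, smul_smul, hc]
      rw [← map_mul, this, map_add, h₁, ← map_add, hPQ, map_one]
    · have : (extend P V - c⁻¹ • Q) * (A - c • Q) = extend P V * A + Q := by
        simp [mul_sub, sub_mul, hQA, hQ, hW', smul_smul, hc]
      rw [← map_mul, this, map_add, h₂, ← map_add, hPQ, map_one]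
  · intro h c hc
    obtain ⟨b, hb₁, hb₂⟩ := isUnit_iff_exists.1 (isFredholm_iff_isUnit_toCalkinZero.1 (h c hc))
    obtain ⟨B, rfl⟩ := toCalkinZero_surjective b
    rw [← map_mul, ← map_one toCalkinZero] at hb₁ hb₂
    -- Since this operator commutes with `P` exactly, compressing its inverse modulo finite rank
    -- inverts its compression.
    have hcomm : (P * T * P - c • 1) * P = P * (P * T * P - c • 1) := by
      simp only [sub_mul, mul_sub, mul_assoc, hPP, smul_mul_assoc, mul_smul_comm, one_mul, mul_one]
      rw [← mul_assoc P P, hPP]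
    have hT : corner P (P * T * P - c • 1) = corner P T - c • 1 := by
      rw [corner_sub, corner_mul_mul hP]
      ext x
      simp [apply_coe_range hP]
    refine isFredholm_iff_isUnit_toCalkinZero.2 (isUnit_iff_exists.2
      ⟨toCalkinZero (corner P B), ?_, ?_⟩)
    · rw [← map_mul, ← hT, corner_mul_corner, hcomm, ← map_one toCalkinZero, ← corner_one hP,
        ← toCalkinZero_corner_congr hb₁]
      congr 1
      ext x
      simp [apply_apply_of_isIdempotentElem hP]
    · rw [← map_mul, ← hT, corner_mul_corner, mul_assoc, ← hcomm, ← map_one toCalkinZero,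
        ← corner_one hP, ← toCalkinZero_corner_congr hb₂]
      congr 1
      ext x
      simp [apply_coe_range hP]

end Corner

/-! ### The equivalences and the finite rank decomposition -/

section Main

variable {X : Type*} [NormedAddCommGroup X] [NormedSpace ℂ X] {P T : X →L[ℂ] X}

theorem mul_self_mul_eq {A : Type*} [Ring A] {p t : A} (hp : IsIdempotentElem p)
    (h : p * t = t * p) : p * t * p = p * t := by
  rw [mul_assoc, ← h, ← mul_assoc, hp.eq]

/-- Quasinilpotency does not pass along `C₀(X) → C(X)` formally, since lifts of commuting elements
need not commute; it goes through the Riesz property of `P * T`. The other conditions are simply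
mapped. -/
theorem IsRightAssociatedZero.isRightAssociated [CompleteSpace X]
    (h : IsRightAssociatedZero P T) : IsRightAssociated P T where
  idem := h.idem
  comm := by
    simpa using congrArg calkinZeroToCalkin (h.comm _ rfl)
  quasinilpotent := by
    have := h.quasinilpotent
    rw [← map_mul, ← isRiesz_iff_isQuasinilpotent_toCalkinZero,
      isRiesz_iff_isQuasinilpotent_toCalkin, map_mul] at this
    exact this
  rightInvertible := by
    obtain ⟨h₁, b, h₂, h₃⟩ := h.rightInvertible
    refine ⟨?_, calkinZeroToCalkin b, ?_, ?_⟩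
    · simpa using congrArg calkinZeroToCalkin h₁
    · simpa using congrArg calkinZeroToCalkin h₂
    · simpa using congrArg calkinZeroToCalkin h₃

/-- If `P` is associated to `T` in the Calkin algebra, then `T` compresses to a Riesz operator on
the range of `P`. -/
theorem IsRightAssociated.isRiesz_compression [CompleteSpace X] (h : IsRightAssociated P T) :
    IsRiesz (compression P T) := by
  rw [compression_eq_corner h.idem, isRiesz_corner_iff h.idem,
    isRiesz_iff_isQuasinilpotent_toCalkin, map_mul, map_mul,
    mul_self_mul_eq (h.idem.map toCalkin) h.comm]
  exact h.quasinilpotent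

/-- If `P` is associated to `T` in the Calkin algebra, then `T` compresses to a right semi-Fredholm
operator on the kernel of `P`. -/
theorem IsRightAssociated.isRightSemiFredholm_compression [CompleteSpace X]
    (h : IsRightAssociated P T) : IsRightSemiFredholm (compression (1 - P) T) := by
  have hQ := h.idem.one_sub
  have := completeSpace_range hQ
  obtain ⟨-, b, hb₁, hb₂⟩ := h.rightInvertible
  obtain ⟨B, rfl⟩ := toCalkin_surjective b
  rw [compression_eq_corner hQ, isRightSemiFredholm_iff_toCalkin]
  refine ⟨toCalkin (corner (1 - P) B), ?_⟩
  rw [← map_mul, corner_mul_corner, ← corner_mul_mul hQ, ← map_one toCalkin, ← corner_one hQ]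
  rw [← corner_mul_mul hQ 1]
  -- With both sides written as compressions of `q _ q`, where `q = 1 - p`, it suffices to compute
  -- in the Calkin algebra of `X`: `q` commutes with `b`, and `q * t = q * (t + p)` because `q * p =
  -- 0`.
  refine toCalkin_corner_congr ?_
  simp only [map_mul, map_sub, map_one]
  set p := toCalkin P
  set t := toCalkin T
  set b := toCalkin B
  have hp : p * p = p := h.idem.map toCalkin
  have hq : (1 - p) * (1 - p) = 1 - p := by simp [sub_mul, mul_sub, hp]
  have hbq : (1 - p) * b = b * (1 - p) := by rw [sub_mul, mul_sub, hb₁, one_mul, mul_one]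
  have htq : (1 - p) * t = (1 - p) * (t + p) := by rw [mul_add, sub_mul 1 p p, hp]; simp
  calc (1 - p) * (t * (1 - p) * b) * (1 - p)
      = (1 - p) * t * ((1 - p) * b) * (1 - p) := by simp only [mul_assoc]
    _ = (1 - p) * ((t + p) * b) * ((1 - p) * (1 - p)) := by
        rw [hbq, htq]; simp only [mul_assoc]
    _ = (1 - p) * 1 * (1 - p) := by rw [hb₂, hq]

/-- If `π(P)` commutes with `π(T)` and the compressions of `T` to the range and the kernel of `P`
are Riesz and right semi-Fredholm, then `π(T)` is right `π(P)`-invertible. -/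
theorem isRightPInvertible_of_compression [CompleteSpace X] (hP : IsIdempotentElem P)
    (hcomm : toCalkinZero P * toCalkinZero T = toCalkinZero T * toCalkinZero P)
    (h₁ : IsRiesz (compression P T)) (h₂ : IsRightSemiFredholm (compression (1 - P) T)) :
    IsRightPInvertible (toCalkinZero P) (toCalkinZero T) := by
  have hQ := hP.one_sub
  have := completeSpace_range hQ
  rw [compression_eq_corner hP] at h₁
  rw [compression_eq_corner hQ, isRightSemiFredholm_iff_toCalkinZero] at h₂
  -- On the range of `P`, `T + P` acts as `T₁ + 1`, so the Riesz property is needed only at `-1`.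
  obtain ⟨v, hv⟩ := (isFredholm_iff_isUnit_toCalkinZero.1
    (h₁ (-1) (neg_ne_zero.2 one_ne_zero))).exists_right_inv
  obtain ⟨w, hw⟩ := h₂
  obtain ⟨V, rfl⟩ := toCalkinZero_surjective v
  obtain ⟨W, rfl⟩ := toCalkinZero_surjective w
  rw [← map_mul, ← map_one toCalkinZero] at hv hw
  have hv' := toCalkinZero_extend_congr hv
  have hw' := toCalkinZero_extend_congr hw
  have hT : extend P (corner P T - (-1 : ℂ) • 1) = P * T * P + P := by
    ext x
    simp
  rw [← extend_mul_extend hP, extend_one, hT] at hv'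
  rw [← extend_mul_extend hQ, extend_one, extend_corner] at hw'
  have e₁ := mul_extend hP V
  have e₂ := extend_mul hP V
  have e₃ := mul_extend hQ W
  have e₄ := extend_mul hQ W
  generalize extend P V = V' at *
  generalize extend (1 - P) W = W' at *
  have f₁ := congrArg toCalkinZero e₁
  have f₂ := congrArg toCalkinZero e₂
  have f₃ := congrArg toCalkinZero e₃
  have f₄ := congrArg toCalkinZero e₄
  have hp : toCalkinZero P * toCalkinZero P = toCalkinZero P := hP.map toCalkinZero
  simp only [map_mul, map_add, map_sub, map_one] at hv' hw' f₁ f₂ f₃ f₄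
  generalize toCalkinZero P = p at *
  generalize toCalkinZero T = t at *
  generalize toCalkinZero V' = a at *
  generalize toCalkinZero W' = b at *
  have g₃ : p * b = 0 := by rw [sub_mul, one_mul, sub_eq_self] at f₃; exact f₃
  have g₄ : b * p = 0 := by rw [mul_sub, mul_one, sub_eq_self] at f₄; exact f₄
  have hta : t * a = p * t * p * a := by
    rw [mul_self_mul_eq hp hcomm, hcomm, mul_assoc, f₁]
  have htb : t * b = (1 - p) * t * (1 - p) * b := by
    rw [mul_assoc, f₃, sub_mul, hcomm, sub_mul, mul_assoc t p b, g₃]; simp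
  -- The sum of the two block inverses: `a` for `T₁ + 1`, and `b` for `T₂`, where the summand `p`
  -- vanishes.
  refine ⟨hcomm.symm, a + b, ?_, ?_⟩
  · rw [add_mul, mul_add, f₁, f₂, g₃, g₄]
  · rw [add_mul, mul_add, mul_add, g₃, hta, htb, hw']
    rw [add_mul] at hv'
    rw [add_zero, add_right_comm, hv', add_sub_cancel]

theorem isRightAssociatedZero_of_compression [CompleteSpace X] (hP : IsIdempotentElem P)
    (hcomm : toCalkinZero P ∈ comm2 (toCalkinZero T))
    (h₁ : IsRiesz (compression P T)) (h₂ : IsRightSemiFredholm (compression (1 - P) T)) :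
    IsRightAssociatedZero P T where
  idem := hP
  comm := hcomm
  quasinilpotent := by
    rw [← mul_self_mul_eq (hP.map toCalkinZero) (hcomm _ rfl), ← map_mul, ← map_mul,
      ← isRiesz_iff_isQuasinilpotent_toCalkinZero, ← isRiesz_corner_iff hP,
      ← compression_eq_corner hP]
    exact h₁
  rightInvertible := isRightPInvertible_of_compression hP (hcomm _ rfl) h₁ h₂

/-- The block diagonal part of `T` with respect to `X = R(P) ⊕ N(P)` is Riesz-right semi-Fredholm
when its blocks are Riesz and right semi-Fredholm. -/
theorem isRieszRightSemiFredholm_of_compression (hP : IsIdempotentElem P)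
    (h₁ : IsRiesz (compression P T)) (h₂ : IsRightSemiFredholm (compression (1 - P) T)) :
    IsRieszRightSemiFredholm (P * T * P + (1 - P) * T * (1 - P)) := by
  have hQ := hP.one_sub
  have hPx := apply_coe_range hP
  have hQx (x : (1 - P : X →L[ℂ] X).range) : P (x : X) = 0 := by
    have := apply_coe_range hQ x
    simpa using this
  have hM (x : P.range) : (P * T * P + (1 - P) * T * (1 - P)) (x : X) = compression P T x := by
    change P (T (P x)) + (1 - P) (T ((x : X) - P x)) = P (T (P x))
    rw [hPx, sub_self, map_zero, map_zero, add_zero]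
  have hN (x : (1 - P : X →L[ℂ] X).range) :
      (P * T * P + (1 - P) * T * (1 - P)) (x : X) = compression (1 - P) T x := by
    change P (T (P x)) + (1 - P) (T ((1 - P) x)) = (1 - P) (T ((1 - P) x))
    rw [hQx, map_zero, map_zero, zero_add]
  refine ⟨P.range, (1 - P : X →L[ℂ] X).range,
    fun x hx => hM ⟨x, hx⟩ ▸ (compression P T ⟨x, hx⟩).2,
    fun x hx => hN ⟨x, hx⟩ ▸ (compression (1 - P) T ⟨x, hx⟩).2,
    isClosed_range_of_isIdempotentElem hP, isClosed_range_of_isIdempotentElem hQ, ?_, ?_, ?_⟩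
  · refine ⟨Submodule.disjoint_def.2 fun x hx hx' => (hPx ⟨x, hx⟩).symm.trans (hQx ⟨x, hx'⟩),
      codisjoint_iff_le_sup.2 fun x _ => ?_⟩
    exact Submodule.mem_sup.2 ⟨P x, ⟨x, rfl⟩, (1 - P) x, ⟨x, rfl⟩, by simp⟩
  · convert! h₁ using 1
    ext x
    exact hM x
  · convert! h₂ using 1
    ext x
    exact hN x

/-- The difference consists of the off-diagonal blocks `P * T * (1 - P)` and `(1 - P) * T * P`,
which vanish in `C₀(X)` when the classes of `P` and `T` commute. -/
theorem hasFiniteRange_sub_of_comm (hP : IsIdempotentElem P)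
    (h : toCalkinZero P * toCalkinZero T = toCalkinZero T * toCalkinZero P) :
    ((T - (P * T * P + (1 - P) * T * (1 - P)) : X →L[ℂ] X) : X →ₗ[ℂ] X).HasFiniteRange := by
  rw [← toCalkinZero_eq_zero]
  have := mul_self_mul_eq (hP.map toCalkinZero) h
  simp only [map_sub, map_add, map_mul, sub_mul, mul_sub, one_mul, mul_one]
  rw [this, h]
  abel

end Main

end PseudoFredholm

theorem theorem3p7 {X : Type*} [NormedAddCommGroup X] [NormedSpace ℂ X] [CompleteSpace X]
    (T : X →L[ℂ] X) :
    List.TFAE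
      [PseudoFredholm.IsRightGDrazinInvertibleZero T,
       PseudoFredholm.IsRightPseudoSemiBFredholm T ∧
         ∃ P : X →L[ℂ] X, PseudoFredholm.IsRightAssociated P T ∧
           PseudoFredholm.toCalkinZero P ∈ PseudoFredholm.comm2 (PseudoFredholm.toCalkinZero T),
       ∃ P : X →L[ℂ] X, IsIdempotentElem P ∧
         PseudoFredholm.toCalkinZero P ∈ PseudoFredholm.comm2 (PseudoFredholm.toCalkinZero T) ∧
           PseudoFredholm.IsRiesz (PseudoFredholm.compression P T) ∧
           PseudoFredholm.IsRightSemiFredholm (PseudoFredholm.compression (1 - P) T)] ∧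
    (PseudoFredholm.IsRightGDrazinInvertibleZero T →
      ∃ R : X →L[ℂ] X, PseudoFredholm.IsRieszRightSemiFredholm R ∧
        ((T - R : X →L[ℂ] X) : X →ₗ[ℂ] X).HasFiniteRange) := by
  constructor
  · tfae_have 1 → 2 := by
      rintro ⟨P, hP⟩
      exact ⟨⟨P, hP.isRightAssociated⟩, P, hP.isRightAssociated, hP.comm⟩
    tfae_have 2 → 3 := by
      rintro ⟨-, P, hP, hcomm⟩
      exact ⟨P, hP.idem, hcomm, hP.isRiesz_compression, hP.isRightSemiFredholm_compression⟩
    tfae_have 3 → 1 := by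
      rintro ⟨P, hP, hcomm, h₁, h₂⟩
      exact ⟨P, PseudoFredholm.isRightAssociatedZero_of_compression hP hcomm h₁ h₂⟩
    tfae_finish
  · rintro ⟨P, hP⟩
    exact ⟨_, PseudoFredholm.isRieszRightSemiFredholm_of_compression hP.idem
      hP.isRightAssociated.isRiesz_compression hP.isRightAssociated.isRightSemiFredholm_compression,
      PseudoFredholm.hasFiniteRange_sub_of_comm hP.idem (hP.comm _ rfl)⟩
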